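/- For a finite simple graph $G$ let $\mathrm{Ind}(G)$ be its independence complex: the simplicial complex (identified with its geometric realization) whose vertices are the vertices of $G$ and whose simplices are the independent sets of $G$. Write $N[x]$ for the closed neighbourhood of a vertex $x$ (so $x\in N[x]$) and, for an edge $e=(u,v)$, put $N[e]=N[u]\cup N[v]$. Let $G-e$ be $G$ with the edge $e$ removed, let $G\setminus N[e]$ be the subgraph induced on the vertices outside $N[e]$, and let $e\sqcup(G\setminus N[e])$ be the induced subgraph of $G$ on $u$, $v$ and all vertices outside $N[e]$. $\Sigma$ denotes the unreduced suspension, with $\Sigma\emptyset=S^0$. **Theorem.** Let $G$ be a finite simple graph and $e=(u,v)$ an edge of $G$. Let $T$ be an induced subgraph of $G$ which contains $e$, such that $\mathrm{Ind}(T)$ is contractible and $N[x]\subseteq N[e]$ for every vertex $x$ of $T$. Then the inclusion $$\mathrm{Ind}(e\sqcup(G\setminus N[e]))\hookrightarrow\mathrm{Ind}(G)$$ is null-homotopic. Consequently, there is a homotopy equivalence $$\mathrm{Ind}(G-e)\simeq\mathrm{Ind}(G)\vee\Sigma^2\,\mathrm{Ind}(G\setminus N[e]),$$ where the wedge may be formed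 at any point of the path component of $u$ in $\mathrm{Ind}(G)$ and at a pole of the suspension $\Sigma^2\,\mathrm{Ind}(G\setminus N[e])=\Sigma(\Sigma\,\mathrm{Ind}(G\setminus N[e]))$. -/

import Mathlib

section IndependenceComplexes

namespace IndComplex

/-- The independence complex `Ind(G)`: its vertices are the vertices of `G` and its simplices are
the (nonempty, finite) independent sets of `G`. -/
def Ind {V : Type*} (G : SimpleGraph V) : AbstractSimplicialComplex V where
  faces := {s | s.Nonempty ∧ G.IsIndepSet (s : Set V)}
  isRelLowerSet_faces := fun _ hs =>
    ⟨hs.1, fun _ hts ht => ⟨ht, hs.2.mono (Finset.coe_subset.mpr hts)⟩⟩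
  singleton_mem := fun v => by simp [SimpleGraph.isIndepSet_iff]

/-- The geometric realization of an abstract simplicial complex on a finite vertex set `V`, as a
subspace of `ℝ^V`: the union, over all faces `s`, of the simplex spanned by the unit vectors
`e_v`, `v ∈ s`. -/
def Realization {V : Type*} (K : AbstractSimplicialComplex V) : Set (V → ℝ) :=
  {x | ∃ s ∈ K.faces, (∀ v, 0 ≤ x v) ∧ (∀ v, v ∉ s → x v = 0) ∧ ∑ v ∈ s, x v = 1}

/-- The space `|Ind(G)|`. -/
abbrev IndSpace {V : Type*} (G : SimpleGraph V) : Type _ := Realization (Ind G)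

open Classical in
/-- The vertex `v`, as a point of `|Ind(G)|`. -/
noncomputable def vertexPoint {V : Type*} (G : SimpleGraph V) (v : V) : IndSpace G :=
  ⟨Pi.single v 1, {v}, (Ind G).singleton_mem v, by
    intro w
    by_cases h : w = v
    · subst h; simp
    · simp [h], by
    intro w hw
    simp only [Finset.mem_singleton] at hw
    simp [hw], by simp⟩

open Classical in
/-- The inclusion `|Ind(G[W])| ↪ |Ind(G)|` for a set `W` of vertices: it sends each vertex of `W`
to itself and is affine on simplices, i.e. it extends barycentric coordinates by `0`. -/
noncomputable def indInclusion {V : Type*} (G : SimpleGraph V) (W : Set V) :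
    C(IndSpace (G.induce W), IndSpace G) where
  toFun x := ⟨fun v => if h : v ∈ W then x.1 ⟨v, h⟩ else 0, by
    obtain ⟨x, s, ⟨hne, hind⟩, h0, hsupp, hsum⟩ := x
    refine ⟨s.map (Function.Embedding.subtype _), ⟨by simpa using hne, ?_⟩, ?_, ?_, ?_⟩
    · intro a ha b hb hab
      simp only [Finset.coe_map, Function.Embedding.subtype_apply, Set.mem_image,
        Finset.mem_coe] at ha hb
      obtain ⟨a', ha', rfl⟩ := ha
      obtain ⟨b', hb', rfl⟩ := hb
      exact hind ha' hb' (fun h => hab (by rw [h]))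
    · intro v
      dsimp only
      split_ifs with h
      · exact h0 _
      · exact le_rfl
    · intro v hv
      dsimp only
      split_ifs with h
      · exact hsupp _ (fun hs => hv (Finset.mem_map.mpr ⟨_, hs, rfl⟩))
      · rfl
    · simpa using hsum⟩
  continuous_toFun := by
    refine Continuous.subtype_mk (continuous_pi fun v => ?_) _
    by_cases h : v ∈ W
    · simp only [h, dite_true]
      exact (continuous_apply _).comp continuous_subtype_val
    · simp only [h, dite_false]
      exact continuous_const

/-- The closed neighbourhood `N[x]` of a vertex. -/
def closedNbhd {V : Type*} (G : SimpleGraph V) (x : V) : Set V := insert x (G.neighborSet x)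

/-- The closed neighbourhood `N[e] = N[u] ∪ N[v]` of an edge `e = (u,v)`. -/
def closedNbhdEdge {V : Type*} (G : SimpleGraph V) (u v : V) : Set V :=
  closedNbhd G u ∪ closedNbhd G v

/-- The identifications which define the unreduced suspension of `X`: starting from the disjoint
union of `X × [0,1]` and two points, `X × {0}` is glued to the first point and `X × {1}` to the
second one. -/
inductive SuspensionRel (X : Type*) :
    (X × unitInterval) ⊕ Bool → (X × unitInterval) ⊕ Bool → Prop
  | bot (x : X) : SuspensionRel X (Sum.inl (x, 0)) (Sum.inr false)
  | top (x : X) : SuspensionRel X (Sum.inl (x, 1)) (Sum.inr true)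

/-- The unreduced suspension `Σ X`, with the quotient topology. The two poles are always present,
so that the suspension of the empty space is the two-point space `S⁰`, as for the join
`S⁰ * X`. -/
def Suspension (X : Type*) : Type _ := Quot (SuspensionRel X)

instance (X : Type*) [TopologicalSpace X] : TopologicalSpace (Suspension X) :=
  inferInstanceAs (TopologicalSpace (Quot (SuspensionRel X)))

/-- The pole of `Σ X` at the parameter value `0`. -/
def Suspension.pole (X : Type*) : Suspension X := Quot.mk _ (Sum.inr false)

/-- The identification of the two base points in a disjoint union `X ⊔ Y`. -/
inductive WedgeRel {X Y : Type*} (p : X) (q : Y) : X ⊕ Y → X ⊕ Y → Prop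
  | glue : WedgeRel p q (Sum.inl p) (Sum.inr q)

/-- The wedge sum `X ∨ Y` of the pointed spaces `(X, p)` and `(Y, q)`, with the quotient
topology. -/
def Wedge {X Y : Type*} (p : X) (q : Y) : Type _ := Quot (WedgeRel p q)

instance {X Y : Type*} [TopologicalSpace X] [TopologicalSpace Y] (p : X) (q : Y) :
    TopologicalSpace (Wedge p q) :=
  inferInstanceAs (TopologicalSpace (Quot (WedgeRel p q)))

end IndComplex

end IndependenceComplexes

/-! Write `L` for the independence complex of `G \ N[e]`. A simplex of `Ind(G - e)` that is missing
from `Ind(G)` contains both `u` and `v`, and its other vertices lie outside `N[e]`. So `Ind(G - e)`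
is `Ind(G)` with `e * L` attached along `{u, v} * L`. The former is the cone over the latter with
apex the midpoint of `e`, and the latter is both `Ind(e ⊔ (G \ N[e]))` and `Σ L`. Hence `Ind(G - e)`
is the mapping cone of `Σ L → Ind(G)` (`coneHomeomorph`).

This map is null-homotopic (`indInclusion_homotopic_const`): no vertex of `T` has a neighbour
outside `N[e]`, so the mass at `v` can be carried to `u` along a path in `Ind(T)` while the part in
`L` stays fixed. What results lies in the star of `u`.

Homotopic maps have equivalent mapping cones (`homotopyEquivOfHomotopy`), and the cone of a constant
map is a wedge with a suspension (`constHomeomorph`), here `Σ (Σ L)`. -/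

namespace IndComplex

/-! ### Barycentric coordinates on the independence complex -/

section Realization

variable {V : Type*}

/-- The face can always be taken to be the support of `x`, and independence is a condition on pairs,
so it becomes a condition on pairs of coordinates. -/
theorem mem_realization_ind_iff [Fintype V] {G : SimpleGraph V} {x : V → ℝ} :
    x ∈ Realization (Ind G) ↔
      (∀ w, 0 ≤ x w) ∧ ∑ w, x w = 1 ∧ ∀ a b, G.Adj a b → x a = 0 ∨ x b = 0 := by
  classical
  constructor
  · rintro ⟨s, hs, h0, hsupp, hsum⟩
    refine ⟨h0, ?_, fun a b hab => ?_⟩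
    · rw [← hsum]
      exact (Finset.sum_subset s.subset_univ fun w _ hw => hsupp w hw).symm
    · by_contra! h
      exact hs.2 (not_imp_comm.1 (hsupp a) h.1) (not_imp_comm.1 (hsupp b) h.2) hab.ne hab
  · rintro ⟨h0, hsum, hind⟩
    have hfilter : ∑ w with x w ≠ 0, x w = 1 := by rw [Finset.sum_filter_ne_zero, hsum]
    refine ⟨Finset.univ.filter fun w => x w ≠ 0, ⟨?_, ?_⟩, h0, fun w hw => by simpa using hw,
      hfilter⟩
    · exact Finset.nonempty_of_sum_ne_zero (hfilter.trans_ne one_ne_zero)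
    · intro a ha b hb _ hab
      simp only [Finset.coe_filter, Finset.mem_univ, true_and, Set.mem_ofPred_eq] at ha hb
      exact (hind a b hab).elim ha hb

theorem IndSpace.nonneg {G : SimpleGraph V} (x : IndSpace G) (w : V) : 0 ≤ x.1 w := by
  obtain ⟨_, _, _, h, _⟩ := x
  exact h w

theorem IndSpace.sum_eq_one [Fintype V] {G : SimpleGraph V} (x : IndSpace G) :
    ∑ w, x.1 w = 1 :=
  (mem_realization_ind_iff.1 x.2).2.1

theorem IndSpace.eq_zero_or [Finite V] {G : SimpleGraph V} (x : IndSpace G) {a b : V}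
    (h : G.Adj a b) : x.1 a = 0 ∨ x.1 b = 0 := by
  have := Fintype.ofFinite V
  exact (mem_realization_ind_iff.1 x.2).2.2 a b h

/-- A closed subset of the cube. Compactness later turns a continuous bijection into a
homeomorphism. -/
instance [Finite V] (G : SimpleGraph V) : CompactSpace (IndSpace G) := by
  have := Fintype.ofFinite V
  rw [← isCompact_iff_compactSpace]
  have hset : Realization (Ind G) = Set.Icc (0 : V → ℝ) 1 ∩
      ({x | ∑ w, x w = 1} ∩ ⋂ a, ⋂ b, ⋂ (_ : G.Adj a b), {x | x a = 0 ∨ x b = 0}) := by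
    ext x
    simp only [mem_realization_ind_iff, Set.mem_inter_iff, Set.mem_Icc, Set.mem_ofPred_eq,
      Set.mem_iInter, Pi.le_def, Pi.zero_apply, Pi.one_apply]
    refine ⟨fun h => ⟨⟨h.1, fun w => ?_⟩, h.2⟩, fun h => ⟨h.1.1, h.2⟩⟩
    rw [← h.2.1]
    exact Finset.single_le_sum (fun i _ => h.1 i) (Finset.mem_univ w)
  rw [hset]
  refine isCompact_Icc.inter_right (IsClosed.inter ?_ ?_)
  · exact isClosed_eq (by fun_prop) continuous_const
  · refine isClosed_iInter fun a => isClosed_iInter fun b => isClosed_iInter fun _ => ?_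
    exact (isClosed_eq (continuous_apply a) continuous_const).union
      (isClosed_eq (continuous_apply b) continuous_const)

theorem indInclusion_apply_of_mem {G : SimpleGraph V} {W : Set V} (x : IndSpace (G.induce W))
    {w : V} (hw : w ∈ W) : (indInclusion G W x).1 w = x.1 ⟨w, hw⟩ := dif_pos hw

theorem indInclusion_apply_of_notMem {G : SimpleGraph V} {W : Set V} (x : IndSpace (G.induce W))
    {w : V} (hw : w ∉ W) : (indInclusion G W x).1 w = 0 := dif_neg hw

theorem indInclusion_injective (G : SimpleGraph V) (W : Set V) :
    Function.Injective (indInclusion G W) := by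
  intro x y h
  ext w
  rw [← indInclusion_apply_of_mem x w.2, ← indInclusion_apply_of_mem y w.2, h]

/-- A point of `|Ind(G)|` supported on `W`, as a point of `|Ind(G[W])|`. -/
def indRestrict [Finite V] {G : SimpleGraph V} {W : Set V} (x : IndSpace G)
    (hx : ∀ w ∉ W, x.1 w = 0) : IndSpace (G.induce W) :=
  ⟨fun w => x.1 w, by
    classical
    have := Fintype.ofFinite V
    refine mem_realization_ind_iff.2 ⟨fun w => x.nonneg w, ?_, fun a b hab => x.eq_zero_or hab⟩
    rw [← x.sum_eq_one]
    exact Fintype.sum_of_injective Subtype.val Subtype.val_injective _ _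
      (fun w hw => hx w (by simpa using hw)) fun _ => rfl⟩

theorem indInclusion_indRestrict [Finite V] {G : SimpleGraph V} {W : Set V} (x : IndSpace G)
    (hx : ∀ w ∉ W, x.1 w = 0) : indInclusion G W (indRestrict x hx) = x := by
  ext w
  by_cases hw : w ∈ W
  · exact indInclusion_apply_of_mem _ hw
  · rw [indInclusion_apply_of_notMem _ hw, hx w hw]

open Classical in
theorem vertexPoint_apply (G : SimpleGraph V) (v w : V) :
    (vertexPoint G v).1 w = if w = v then 1 else 0 := by
  simp [vertexPoint, Pi.single_apply]

open Classical in
/-- The coordinates of a point away from the vertices `u` and `v`. -/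
noncomputable def coordsOff (u v : V) (x : V → ℝ) (w : V) : ℝ := if w = u ∨ w = v then 0 else x w

theorem coordsOff_nonneg {u v : V} {x : V → ℝ} (hx : ∀ w, 0 ≤ x w) (w : V) :
    0 ≤ coordsOff u v x w := by
  unfold coordsOff
  split_ifs
  exacts [le_rfl, hx w]

open Classical in
theorem coordsOff_add {u v : V} (huv : u ≠ v) (x : V → ℝ) (w : V) :
    (if w = u then x u else 0) + (if w = v then x v else 0) + coordsOff u v x w = x w := by
  unfold coordsOff
  by_cases hu : w = u
  · subst hu; simp [huv]
  · by_cases hv : w = v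
    · subst hv; simp [hu]
    · simp [hu, hv]

theorem sum_coordsOff [Fintype V] {u v : V} (huv : u ≠ v) (x : V → ℝ) :
    ∑ w, coordsOff u v x w = ∑ w, x w - x u - x v := by
  classical
  have h : ∑ w, x w = x u + x v + ∑ w, coordsOff u v x w := by
    rw [← Finset.sum_congr rfl fun w _ => coordsOff_add huv x w]
    simp [Finset.sum_add_distrib]
  linarith

theorem continuous_coordsOff (u v w : V) : Continuous fun x : V → ℝ => coordsOff u v x w := by
  unfold coordsOff
  split_ifs
  exacts [continuous_const, continuous_apply w]

end Realization

end IndComplex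

namespace IndComplex

/-! ### Mapping cones -/

section MappingCone

open unitInterval

variable {A X Z : Type*}

/-- The identifications which define the mapping cone of `f : A → X`: the end `A × {0}` of the
cylinder is glued to `X` along `f` and the end `A × {1}` is collapsed to the apex. -/
inductive MappingConeRel (f : A → X) : (X ⊕ A × I) ⊕ Unit → (X ⊕ A × I) ⊕ Unit → Prop
  | bot (a : A) : MappingConeRel f (Sum.inl (Sum.inr (a, 0))) (Sum.inl (Sum.inl (f a)))
  | top (a : A) : MappingConeRel f (Sum.inl (Sum.inr (a, 1))) (Sum.inr ())

/-- The unreduced mapping cone of `f : A → X`. -/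
def MappingCone (f : A → X) : Type _ := Quot (MappingConeRel f)

namespace MappingCone

/-- The inclusion of the target into the mapping cone. -/
def base (f : A → X) (x : X) : MappingCone f := Quot.mk _ (Sum.inl (Sum.inl x))

/-- The structural map from the cylinder to the mapping cone. -/
def side (f : A → X) (q : A × I) : MappingCone f := Quot.mk _ (Sum.inl (Sum.inr q))

/-- The apex of the mapping cone. -/
def apex (f : A → X) : MappingCone f := Quot.mk _ (Sum.inr ())

theorem side_zero (f : A → X) (a : A) : side f (a, 0) = base f (f a) :=
  Quot.sound (MappingConeRel.bot a)

theorem side_one (f : A → X) (a : A) : side f (a, 1) = apex f :=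
  Quot.sound (MappingConeRel.top a)

theorem ind {f : A → X} {P : MappingCone f → Prop} (hb : ∀ x, P (base f x))
    (hs : ∀ a t, P (side f (a, t))) (ha : P (apex f)) (c : MappingCone f) : P c := by
  induction c using Quot.ind with
  | mk c =>
    rcases c with (x | ⟨a, t⟩) | ⟨⟩
    exacts [hb x, hs a t, ha]

variable [TopologicalSpace A] [TopologicalSpace X] [TopologicalSpace Z]

instance (f : A → X) : TopologicalSpace (MappingCone f) :=
  inferInstanceAs (TopologicalSpace (Quot (MappingConeRel f)))

instance (f : A → X) [CompactSpace A] [CompactSpace X] : CompactSpace (MappingCone f) :=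
  inferInstanceAs (CompactSpace (Quot (MappingConeRel f)))

theorem continuous_base (f : A → X) : Continuous (base f) :=
  continuous_quot_mk.comp (continuous_inl.comp continuous_inl)

theorem continuous_side (f : A → X) : Continuous (side f) :=
  continuous_quot_mk.comp (continuous_inl.comp continuous_inr)

/-- The universal property of the mapping cone. -/
def desc (f : A → X) (g : C(X, Z)) (h : C(A × I, Z)) (z : Z) (h0 : ∀ a, h (a, 0) = g (f a))
    (h1 : ∀ a, h (a, 1) = z) : C(MappingCone f, Z) where
  toFun := Quot.lift (Sum.elim (Sum.elim g h) fun _ => z) (by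
    rintro _ _ (a | a)
    exacts [h0 a, h1 a])
  continuous_toFun := continuous_quot_lift _
    ((g.continuous.sumElim h.continuous).sumElim continuous_const)

end MappingCone

end MappingCone

end IndComplex

namespace IndComplex

/-! ### Homotopy invariance of the mapping cone, and the cone of a constant map -/

section MappingConeHomotopy

open unitInterval

namespace MappingCone

variable {A X Z : Type*} [TopologicalSpace A] [TopologicalSpace X] [TopologicalSpace Z]

/-- The path in the mapping cone of `f`, parametrized by the real line, which runs backwards along
a homotopy `H` starting at `f` for `r ≤ 0` and along the cone line of `a` for `0 ≤ r`. -/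
noncomputable def track {f g : C(A, X)} (H : f.Homotopy g) :
    C(A × ℝ, MappingCone (f : A → X)) where
  toFun q := if q.2 ≤ 0 then base f (H (Set.projIcc 0 1 zero_le_one (-q.2), q.1))
    else side f (q.1, Set.projIcc 0 1 zero_le_one q.2)
  continuous_toFun := by
    refine Continuous.if_le ((continuous_base _).comp ?_) ((continuous_side _).comp ?_)
      continuous_snd continuous_const ?_
    · exact H.continuous.comp
        ((continuous_projIcc.comp continuous_snd.neg).prodMk continuous_fst)
    · exact continuous_fst.prodMk (continuous_projIcc.comp continuous_snd)
    · rintro ⟨a, r⟩ hr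
      obtain rfl : r = 0 := hr
      simp [side_zero]

theorem track_of_nonpos {f g : C(A, X)} (H : f.Homotopy g) (a : A) {r : ℝ} (hr : r ≤ 0) :
    track H (a, r) = base f (H (Set.projIcc 0 1 zero_le_one (-r), a)) := if_pos hr

theorem track_of_nonneg {f g : C(A, X)} (H : f.Homotopy g) (a : A) {r : ℝ} (hr : 0 ≤ r) :
    track H (a, r) = side f (a, Set.projIcc 0 1 zero_le_one r) := by
  rcases hr.eq_or_lt with rfl | hr
  · rw [track_of_nonpos H a le_rfl]
    simp [side_zero]
  · exact if_neg hr.not_ge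

theorem track_coe {f g : C(A, X)} (H : f.Homotopy g) (a : A) (t : I) :
    track H (a, t) = side f (a, t) := by
  rw [track_of_nonneg H a t.2.1, Set.projIcc_val]

theorem track_zero {f g : C(A, X)} (H : f.Homotopy g) (a : A) :
    track H (a, 0) = base f (f a) := by
  rw [← side_zero]
  simpa using track_coe H a 0

theorem track_one {f g : C(A, X)} (H : f.Homotopy g) (a : A) : track H (a, 1) = apex f := by
  rw [← side_one f a]
  simpa using track_coe H a 1

theorem track_neg_one {f g : C(A, X)} (H : f.Homotopy g) (a : A) :
    track H (a, -1) = base f (g a) := by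
  rw [track_of_nonpos H a (by norm_num)]
  simp

/-- The map of mapping cones induced by a homotopy. -/
noncomputable def mapOfHomotopy {f g : C(A, X)} (H : f.Homotopy g) :
    C(MappingCone (f : A → X), MappingCone (g : A → X)) :=
  desc f ⟨base g, continuous_base _⟩
    -- As `2 * t - 1` runs over `[-1, 1]`, the first half follows `H` from `f a` to `g a` and the
    -- second half is the cone line of `g`.
    ((track H.symm).comp ⟨fun q => (q.1, 2 * (q.2 : ℝ) - 1), by fun_prop⟩) (apex g)
    (fun a => by simpa using track_neg_one H.symm a)
    (fun a => by
      have : (2 : ℝ) - 1 = 1 := by norm_num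
      simpa [this] using track_one H.symm a)

theorem mapOfHomotopy_side {f g : C(A, X)} (H : f.Homotopy g) (a : A) (t : I) :
    mapOfHomotopy H (side f (a, t)) = track H.symm (a, 2 * (t : ℝ) - 1) := rfl

/-- The reparametrization of the cone line by which `mapOfHomotopy H.symm ∘ mapOfHomotopy H`
differs from the identity. -/
noncomputable def reparam (t : ℝ) : ℝ := if t ≤ 1 / 2 then -(2 * t) else 4 * t - 3

theorem continuous_reparam : Continuous reparam :=
  Continuous.if_le (by fun_prop) (by fun_prop) continuous_id continuous_const
    (by rintro t rfl; norm_num)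

theorem mapOfHomotopy_symm_comp_side {f g : C(A, X)} (H : f.Homotopy g) (a : A) (t : I) :
    mapOfHomotopy H.symm (mapOfHomotopy H (side f (a, t))) = track H (a, reparam t) := by
  have ht := t.2
  rw [mapOfHomotopy_side]
  by_cases h : (t : ℝ) ≤ 1 / 2
  · have h2 : reparam t = -(2 * t) := if_pos h
    rw [h2, track_of_nonpos _ _ (by linarith), track_of_nonpos _ _ (by linarith [ht.1])]
    change base f _ = _
    congr 1
    rw [ContinuousMap.Homotopy.symm_apply]
    congr 2
    ext
    rw [Set.projIcc_of_mem zero_le_one (x := -(2 * (t : ℝ) - 1)) ⟨by linarith, by linarith [ht.1]⟩,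
      Set.projIcc_of_mem zero_le_one (x := - -(2 * (t : ℝ))) ⟨by linarith [ht.1], by linarith⟩]
    simp only [unitInterval.coe_symm_eq]
    ring
  · have h2 : reparam t = 4 * t - 3 := if_neg h
    push Not at h
    rw [track_of_nonneg _ _ (by linarith), mapOfHomotopy_side, h2,
      Set.projIcc_of_mem zero_le_one (x := 2 * (t : ℝ) - 1) ⟨by linarith, by linarith [ht.2]⟩]
    rw [ContinuousMap.Homotopy.symm_symm]
    congr 2
    change 2 * (2 * (t : ℝ) - 1) - 1 = _
    ring

/-- Both maps factor on cone lines through `track H`, whose parameter ranges over all of `ℝ`. The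
straight line from `reparam` to the identity therefore gives a homotopy, and it fixes the parameters
`0` and `1`. -/
theorem mapOfHomotopy_symm_comp {f g : C(A, X)} (H : f.Homotopy g) :
    ((mapOfHomotopy H.symm).comp (mapOfHomotopy H)).Homotopic (ContinuousMap.id _) := by
  let slide : C((A × I) × I, MappingCone (f : A → X)) := (track H).comp
    ⟨fun q => (q.1.1, (1 - (q.2 : ℝ)) * reparam q.1.2 + q.2 * q.1.2), by
      have := continuous_reparam
      fun_prop⟩
  -- The curried form lets the universal property of the cone define the homotopy, with no need to
  -- describe the product of a quotient with `I`.
  let K : C(MappingCone (f : A → X), C(I, MappingCone (f : A → X))) :=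
    desc f ⟨fun x => ContinuousMap.const I (base f x),
      ContinuousMap.continuous_const'.comp (continuous_base _)⟩ slide.curry
      (ContinuousMap.const I (apex f))
      (fun a => by
        ext s
        have h : reparam 0 = 0 := by norm_num [reparam]
        simpa [slide, h] using track_zero H a)
      (fun a => by
        ext s
        have h : reparam 1 = 1 := by norm_num [reparam]
        simpa [slide, h] using track_one H a)
  refine ⟨⟨⟨fun q => K q.2 q.1, by fun_prop⟩, fun c => ?_, fun c => ?_⟩⟩
  · induction c using ind with
    | hb x => rfl
    | hs a t =>
      have h : K (side f (a, t)) 0 = track H (a, reparam t) := by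
        change track H _ = _
        simp
      exact h.trans (mapOfHomotopy_symm_comp_side H a t).symm
    | ha => rfl
  · induction c using ind with
    | hb x => rfl
    | hs a t =>
      have h : K (side f (a, t)) 1 = track H (a, t) := by
        change track H _ = _
        simp
      exact h.trans (track_coe H a t)
    | ha => rfl

/-- Homotopic maps have homotopy equivalent mapping cones. -/
noncomputable def homotopyEquivOfHomotopy {f g : C(A, X)} (H : f.Homotopy g) :
    ContinuousMap.HomotopyEquiv (MappingCone (f : A → X)) (MappingCone (g : A → X)) where
  toFun := mapOfHomotopy H
  invFun := mapOfHomotopy H.symm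
  left_inv := mapOfHomotopy_symm_comp H
  right_inv := by simpa using mapOfHomotopy_symm_comp H.symm

end MappingCone

variable {X Y Z : Type*} [TopologicalSpace X] [TopologicalSpace Y] [TopologicalSpace Z]

/-- The universal property of the suspension. -/
def Suspension.desc (h : C(X × I, Z)) (z₀ z₁ : Z) (h0 : ∀ x, h (x, 0) = z₀)
    (h1 : ∀ x, h (x, 1) = z₁) : C(Suspension X, Z) where
  toFun := Quot.lift (Sum.elim h fun b => bif b then z₁ else z₀) (by
    rintro _ _ (x | x)
    exacts [h0 x, h1 x])
  continuous_toFun := continuous_quot_lift _ (h.continuous.sumElim continuous_of_discreteTopology)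

/-- The universal property of the wedge. -/
def Wedge.desc {p : X} {q : Y} (g : C(X, Z)) (h : C(Y, Z)) (hpq : g p = h q) :
    C(Wedge p q, Z) where
  toFun := Quot.lift (Sum.elim g h) (by
    rintro _ _ ⟨⟩
    exact hpq)
  continuous_toFun := continuous_quot_lift _ (g.continuous.sumElim h.continuous)

instance [CompactSpace X] : CompactSpace (Suspension X) :=
  inferInstanceAs (CompactSpace (Quot (SuspensionRel X)))

/-- The mapping cone of a constant map is a wedge with the suspension. -/
def MappingCone.constHomeomorph (p : X) :
    MappingCone (ContinuousMap.const Y p : Y → X) ≃ₜ Wedge p (Suspension.pole Y) where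
  toFun := MappingCone.desc _ ⟨fun x => Quot.mk _ (Sum.inl x), by
      exact continuous_quot_mk.comp continuous_inl⟩
    ⟨fun q => Quot.mk _ (Sum.inr (Quot.mk _ (Sum.inl q))), by
      exact continuous_quot_mk.comp (continuous_inr.comp (continuous_quot_mk.comp continuous_inl))⟩
    (Quot.mk _ (Sum.inr (Quot.mk _ (Sum.inr true))))
    (fun y => (congrArg (fun z => Quot.mk _ (Sum.inr z)) (Quot.sound (SuspensionRel.bot y))).trans
      (Quot.sound WedgeRel.glue).symm)
    (fun y => congrArg (fun z => Quot.mk _ (Sum.inr z)) (Quot.sound (SuspensionRel.top y)))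
  invFun := Wedge.desc ⟨MappingCone.base _, MappingCone.continuous_base _⟩
    (Suspension.desc ⟨MappingCone.side _, MappingCone.continuous_side _⟩
      (MappingCone.base _ p) (MappingCone.apex _) (MappingCone.side_zero _)
      (MappingCone.side_one _)) rfl
  left_inv c := by
    induction c using MappingCone.ind <;> rfl
  right_inv c := by
    induction c using Quot.ind with
    | mk c =>
      rcases c with x | c
      · rfl
      · induction c using Quot.ind with
        | mk c =>
          rcases c with ⟨y, t⟩ | (_ | _)
          · rfl
          · exact Quot.sound WedgeRel.glue
          · rfl
  continuous_toFun := ContinuousMap.continuous _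
  continuous_invFun := ContinuousMap.continuous _

end MappingConeHomotopy

end IndComplex

namespace IndComplex

/-! ### The null-homotopy -/

section NullHomotopy

open unitInterval

variable {V : Type*} {G : SimpleGraph V} {u v : V} {T : Set V}

theorem ne_of_coordsOff_ne_zero {x : V → ℝ} {w : V}
    (h : coordsOff u v x w ≠ 0) : w ≠ u ∧ w ≠ v ∧ x w ≠ 0 := by
  classical
  unfold coordsOff at h
  split_ifs at h with hw
  · exact absurd rfl h
  · exact ⟨fun h' => hw (.inl h'), fun h' => hw (.inr h'), h⟩

theorem notMem_closedNbhdEdge_of_coordsOff_ne_zero {x : V → ℝ}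
    (hx : ∀ w ∉ ({u, v} ∪ (closedNbhdEdge G u v)ᶜ : Set V), x w = 0) {w : V}
    (h : coordsOff u v x w ≠ 0) : w ∉ closedNbhdEdge G u v := by
  obtain ⟨hu, hv, hw⟩ := ne_of_coordsOff_ne_zero h
  rcases not_imp_comm.1 (hx w) hw with (h | h) | h
  exacts [absurd h hu, absurd h hv, h]

open Classical in
-- The mass of `x` at `v` is redistributed according to `y`. If it is zero, nothing changes.
-- Otherwise `x` vanishes at `u`, so the new support lies in the support of `y` together with
-- vertices outside `N[e]`, and `hN` forbids edges between the two.
theorem replace_mem_realization [Finite V] (huv : G.Adj u v)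
    (hN : ∀ x ∈ T, closedNbhd G x ⊆ closedNbhdEdge G u v) (x y : IndSpace G)
    (hx : ∀ w ∉ ({u, v} ∪ (closedNbhdEdge G u v)ᶜ : Set V), x.1 w = 0)
    (hy : ∀ w ∉ T, y.1 w = 0) :
    (fun w => (if w = u then x.1 u else 0) + x.1 v * y.1 w + coordsOff u v x.1 w) ∈
      Realization (Ind G) := by
  have := Fintype.ofFinite V
  refine mem_realization_ind_iff.2 ⟨fun w => ?_, ?_, fun a b hab => ?_⟩
  · have h1 := coordsOff_nonneg (u := u) (v := v) x.nonneg w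
    have h2 := mul_nonneg (x.nonneg v) (y.nonneg w)
    have h3 : 0 ≤ if w = u then x.1 u else 0 := by
      split_ifs
      exacts [x.nonneg u, le_rfl]
    linarith
  · rw [Finset.sum_add_distrib, Finset.sum_add_distrib, sum_coordsOff huv.ne, ← Finset.mul_sum,
      x.sum_eq_one, y.sum_eq_one]
    simp
  · rcases eq_or_ne (x.1 v) 0 with hv | hv
    · have h : ∀ w, (if w = u then x.1 u else 0) + x.1 v * y.1 w + coordsOff u v x.1 w = x.1 w :=
        fun w => by
          rw [← coordsOff_add huv.ne x.1 w, hv]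
          simp
      simpa only [h] using x.eq_zero_or hab
    · have hu : x.1 u = 0 := (x.eq_zero_or huv).resolve_right hv
      have hcases : ∀ w, (if w = u then x.1 u else 0) + x.1 v * y.1 w + coordsOff u v x.1 w ≠ 0 →
          (w ∈ T ∧ y.1 w ≠ 0) ∨ (w ∉ closedNbhdEdge G u v ∧ x.1 w ≠ 0) := fun w hw => by
        by_cases hc : coordsOff u v x.1 w = 0
        · have hyw : y.1 w ≠ 0 := fun h => hw (by simp [hu, hc, h])
          exact .inl ⟨not_imp_comm.1 (hy w) hyw, hyw⟩
        · exact .inr ⟨notMem_closedNbhdEdge_of_coordsOff_ne_zero hx hc,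
            (ne_of_coordsOff_ne_zero hc).2.2⟩
      by_contra! h
      rcases hcases a h.1 with ⟨ha, ha'⟩ | ⟨ha, ha'⟩ <;>
        rcases hcases b h.2 with ⟨hb, hb'⟩ | ⟨hb, hb'⟩
      · exact (y.eq_zero_or hab).elim ha' hb'
      · exact hb (hN a ha (.inr hab))
      · exact ha (hN b hb (.inr hab.symm))
      · exact (x.eq_zero_or hab).elim ha' hb'

open Classical in
-- The support consists of `u` and vertices outside `N[e]`, none of which is adjacent to `u`: this
-- is the contraction of the star of `u`.
theorem cone_mem_realization [Finite V] (huv : G.Adj u v) (x : IndSpace G)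
    (hx : ∀ w ∉ ({u, v} ∪ (closedNbhdEdge G u v)ᶜ : Set V), x.1 w = 0) (s : I) :
    (fun w => (if w = u then s + (1 - s) * (x.1 u + x.1 v) else 0) +
      (1 - s) * coordsOff u v x.1 w) ∈ Realization (Ind G) := by
  have := Fintype.ofFinite V
  have hs : 0 ≤ 1 - (s : ℝ) := by linarith [s.2.2]
  refine mem_realization_ind_iff.2 ⟨fun w => ?_, ?_, fun a b hab => ?_⟩
  · have h1 := coordsOff_nonneg (u := u) (v := v) x.nonneg w
    have h2 := x.nonneg u
    have h3 := x.nonneg v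
    have h4 := s.2.1
    split_ifs <;> positivity
  · rw [Finset.sum_add_distrib, ← Finset.mul_sum, sum_coordsOff huv.ne, x.sum_eq_one]
    simp
    ring
  · have hcases : ∀ w, (if w = u then s + (1 - s) * (x.1 u + x.1 v) else 0) +
        (1 - s) * coordsOff u v x.1 w ≠ 0 →
          w = u ∨ (w ∉ closedNbhdEdge G u v ∧ x.1 w ≠ 0) := fun w hw => by
      by_cases hc : coordsOff u v x.1 w = 0
      · exact .inl (by_contra fun h => hw (by simp [h, hc]))
      · exact .inr ⟨notMem_closedNbhdEdge_of_coordsOff_ne_zero hx hc,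
          (ne_of_coordsOff_ne_zero hc).2.2⟩
    by_contra! h
    rcases hcases a h.1 with rfl | ⟨ha, ha'⟩ <;> rcases hcases b h.2 with rfl | ⟨hb, hb'⟩
    · exact hab.ne rfl
    · exact hb (.inl (.inr hab))
    · exact ha (.inl (.inr hab.symm))
    · exact (x.eq_zero_or hab).elim ha' hb'

theorem indInclusion_vertexPoint {w : V} (hw : w ∈ T) :
    indInclusion G T (vertexPoint (G.induce T) ⟨w, hw⟩) = vertexPoint G w := by
  classical
  ext z
  by_cases hz : z ∈ T
  · rw [indInclusion_apply_of_mem _ hz, vertexPoint_apply, vertexPoint_apply]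
    simp
  · rw [indInclusion_apply_of_notMem _ hz, vertexPoint_apply, if_neg]
    rintro rfl
    exact hz hw

theorem indInclusion_homotopic_const [Finite V] (huv : G.Adj u v) (huT : u ∈ T) (hvT : v ∈ T)
    (hjoin : Joined (vertexPoint (G.induce T) ⟨v, hvT⟩) (vertexPoint (G.induce T) ⟨u, huT⟩))
    (hN : ∀ x ∈ T, closedNbhd G x ⊆ closedNbhdEdge G u v) :
    (indInclusion G ({u, v} ∪ (closedNbhdEdge G u v)ᶜ)).Homotopic
      (ContinuousMap.const _ (vertexPoint G u)) := by
  classical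
  obtain ⟨γ⟩ := hjoin
  set i := indInclusion G ({u, v} ∪ (closedNbhdEdge G u v)ᶜ)
  have hi : ∀ a, ∀ w ∉ ({u, v} ∪ (closedNbhdEdge G u v)ᶜ : Set V), (i a).1 w = 0 :=
    fun a w hw => indInclusion_apply_of_notMem a hw
  let A := IndSpace (G.induce ({u, v} ∪ (closedNbhdEdge G u v)ᶜ))
  have hcoe : ∀ w, Continuous fun q : I × A => (i q.2).1 w := fun w =>
    (continuous_apply w).comp (continuous_subtype_val.comp (i.continuous.comp continuous_snd))
  have hoff : ∀ w, Continuous fun q : I × A => coordsOff u v (i q.2).1 w := fun w =>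
    (continuous_coordsOff u v w).comp
      (continuous_subtype_val.comp (i.continuous.comp continuous_snd))
  have hγ : ∀ w, Continuous fun q : I × A => (indInclusion G T (γ q.1)).1 w := fun w =>
    (continuous_apply w).comp (continuous_subtype_val.comp
      ((indInclusion G T).continuous.comp (γ.continuous.comp continuous_fst)))
  -- `H₁` moves the mass at `v` along `γ` to `u`; `H₂` then contracts linearly to `u`.
  let H₁ : C(I × A, IndSpace G) :=
    ⟨fun q => ⟨_, replace_mem_realization huv hN (i q.2) (indInclusion G T (γ q.1)) (hi q.2)
      fun w hw => indInclusion_apply_of_notMem _ hw⟩, by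
      refine Continuous.subtype_mk (continuous_pi fun w => ?_) _
      exact ((continuous_if_const _ (fun _ => hcoe u) fun _ => continuous_const).add
        ((hcoe v).mul (hγ w))).add (hoff w)⟩
  have hs : Continuous fun q : I × A => (q.1 : ℝ) := continuous_subtype_val.comp continuous_fst
  let H₂ : C(I × A, IndSpace G) :=
    ⟨fun q => ⟨_, cone_mem_realization huv (i q.2) (hi q.2) q.1⟩, by
      refine Continuous.subtype_mk (continuous_pi fun w => ?_) _
      exact (continuous_if_const _ (fun _ => hs.add ((continuous_const.sub hs).mul
        ((hcoe u).add (hcoe v)))) fun _ => continuous_const).add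
          ((continuous_const.sub hs).mul (hoff w))⟩
  have h₁ : i.Homotopic (H₁.comp ⟨fun a => (1, a), by fun_prop⟩) := by
    refine ⟨⟨H₁, fun a => ?_, fun a => rfl⟩⟩
    ext w
    change (if w = u then (i a).1 u else 0) + (i a).1 v * (indInclusion G T (γ 0)).1 w +
      coordsOff u v (i a).1 w = _
    rw [γ.source, indInclusion_vertexPoint, vertexPoint_apply, mul_ite, mul_one, mul_zero,
      coordsOff_add huv.ne]
  refine h₁.trans ⟨⟨H₂, fun a => ?_, fun a => ?_⟩⟩
  · ext w
    change (if w = u then ((0 : I) : ℝ) + (1 - ((0 : I) : ℝ)) * ((i a).1 u + (i a).1 v) else 0) +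
      (1 - ((0 : I) : ℝ)) * coordsOff u v (i a).1 w = (if w = u then (i a).1 u else 0) +
      (i a).1 v * (indInclusion G T (γ 1)).1 w + coordsOff u v (i a).1 w
    rw [γ.target, indInclusion_vertexPoint, vertexPoint_apply]
    split_ifs <;> simp
  · ext w
    change (if w = u then ((1 : I) : ℝ) + (1 - ((1 : I) : ℝ)) * ((i a).1 u + (i a).1 v) else 0) +
      (1 - ((1 : I) : ℝ)) * coordsOff u v (i a).1 w = (vertexPoint G u).1 w
    rw [vertexPoint_apply]
    simp

end NullHomotopy

end IndComplex

namespace IndComplex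

/-! ### The join of `{u, v}` with `Ind(G \ N[e])` as a suspension -/

section Suspension

open unitInterval

variable {V : Type*} {G : SimpleGraph V} {u v : V}

theorem left_mem_closedNbhdEdge (G : SimpleGraph V) (u v : V) : u ∈ closedNbhdEdge G u v :=
  .inl (.inl rfl)

theorem right_mem_closedNbhdEdge (G : SimpleGraph V) (u v : V) : v ∈ closedNbhdEdge G u v :=
  .inr (.inl rfl)

theorem IndSpace.add_le_one [Finite V] (x : IndSpace G) (huv : u ≠ v) : x.1 u + x.1 v ≤ 1 := by
  have := Fintype.ofFinite V
  have h := sum_coordsOff huv x.1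
  rw [x.sum_eq_one] at h
  have := Finset.sum_nonneg fun w (_ : w ∈ Finset.univ) =>
    coordsOff_nonneg (u := u) (v := v) x.nonneg w
  linarith

theorem IndSpace.coordsOff_eq_zero [Finite V] (x : IndSpace G) (huv : u ≠ v)
    (h : x.1 u + x.1 v = 1) (w : V) : coordsOff u v x.1 w = 0 := by
  have := Fintype.ofFinite V
  have hsum := sum_coordsOff huv x.1
  rw [x.sum_eq_one, sub_sub, h, sub_self] at hsum
  exact (Finset.sum_eq_zero_iff_of_nonneg fun w _ => coordsOff_nonneg x.nonneg w).1 hsum w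
    (Finset.mem_univ w)

open Classical in
/-- The barycentric coordinates of the point with suspension coordinate `t` on the path from `u`
to `v` through the point `x`. -/
noncomputable def suspensionCoords (u v : V) (x : V → ℝ) (t : ℝ) (w : V) : ℝ :=
  (if w = u then max (1 - 2 * t) 0 else 0) + (if w = v then max (2 * t - 1) 0 else 0) +
    (1 - |2 * t - 1|) * x w

theorem max_add_max_eq_abs (t : ℝ) : max (1 - 2 * t) 0 + max (2 * t - 1) 0 = |2 * t - 1| := by
  rcases le_total (2 * t - 1) 0 with h | h
  · rw [max_eq_left (by linarith), max_eq_right h, abs_of_nonpos h]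
    ring
  · rw [max_eq_right (by linarith), max_eq_left h, abs_of_nonneg h]
    ring

theorem abs_two_mul_sub_one_le (t : I) : |2 * (t : ℝ) - 1| ≤ 1 :=
  abs_le.2 ⟨by linarith [t.2.1], by linarith [t.2.2]⟩

theorem suspensionCoords_left (huv : u ≠ v) {x : V → ℝ} (hx : x u = 0) (t : ℝ) :
    suspensionCoords u v x t u = max (1 - 2 * t) 0 := by
  simp [suspensionCoords, huv, hx]

theorem suspensionCoords_right (huv : u ≠ v) {x : V → ℝ} (hx : x v = 0) (t : ℝ) :
    suspensionCoords u v x t v = max (2 * t - 1) 0 := by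
  simp [suspensionCoords, huv.symm, hx]

theorem suspensionCoords_of_ne {w : V} (hu : w ≠ u) (hv : w ≠ v) (x : V → ℝ) (t : ℝ) :
    suspensionCoords u v x t w = (1 - |2 * t - 1|) * x w := by
  simp [suspensionCoords, hu, hv]

/-- At every `t` one of the two maxima vanishes, so `u` and `v` never both carry mass; and `x` lives
outside `N[e]`. -/
theorem suspensionCoords_mem_realization [Finite V] (huv : G.Adj u v)
    (l : IndSpace (G.induce (closedNbhdEdge G u v)ᶜ)) (t : I) :
    suspensionCoords u v (indInclusion G _ l).1 t ∈ Realization (Ind G) := by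
  classical
  have := Fintype.ofFinite V
  have ht : 0 ≤ 1 - |2 * (t : ℝ) - 1| := sub_nonneg.2 (abs_two_mul_sub_one_le t)
  set x := indInclusion G _ l
  have hx : ∀ w ∈ closedNbhdEdge G u v, x.1 w = 0 := fun w hw =>
    indInclusion_apply_of_notMem l (fun h => h hw)
  have hu := suspensionCoords_left huv.ne (hx u (left_mem_closedNbhdEdge G u v)) t
  have hv := suspensionCoords_right huv.ne (hx v (right_mem_closedNbhdEdge G u v)) t
  refine mem_realization_ind_iff.2 ⟨fun w => ?_, ?_, fun a b hab => ?_⟩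
  · have h1 := mul_nonneg ht (x.nonneg w)
    unfold suspensionCoords
    split_ifs <;> positivity
  · simp only [suspensionCoords]
    rw [Finset.sum_add_distrib, Finset.sum_add_distrib, ← Finset.mul_sum, x.sum_eq_one,
      Finset.sum_ite_eq' , Finset.sum_ite_eq']
    simp only [Finset.mem_univ, if_true]
    rw [max_add_max_eq_abs]
    ring
  · have hcases : ∀ w, suspensionCoords u v x.1 t w ≠ 0 →
        (w = u ∨ w = v) ∨ (w ∉ closedNbhdEdge G u v ∧ x.1 w ≠ 0) := fun w hw => by
      by_cases h : w = u ∨ w = v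
      · exact .inl h
      · rw [not_or] at h
        rw [suspensionCoords_of_ne h.1 h.2] at hw
        have hxw := right_ne_zero_of_mul hw
        exact .inr ⟨fun h' => hxw (hx w h'), hxw⟩
    have hend : max (1 - 2 * (t : ℝ)) 0 = 0 ∨ max (2 * (t : ℝ) - 1) 0 = 0 := by
      rcases le_total (2 * (t : ℝ)) 1 with h | h
      · exact .inr (max_eq_right (by linarith))
      · exact .inl (max_eq_right (by linarith))
    rw [← hu, ← hv] at hend
    by_contra! h
    rcases hcases a h.1 with (rfl | rfl) | ⟨ha, ha'⟩ <;>
      rcases hcases b h.2 with (rfl | rfl) | ⟨hb, hb'⟩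
    · exact hab.ne rfl
    · exact hend.elim h.1 h.2
    · exact hb (.inl (.inr hab))
    · exact hend.elim h.2 h.1
    · exact hab.ne rfl
    · exact hb (.inr (.inr hab))
    · exact ha (.inl (.inr hab.symm))
    · exact ha (.inr (.inr hab.symm))
    · exact (x.eq_zero_or hab).elim ha' hb'

theorem suspensionCoords_zero (x : V → ℝ) :
    suspensionCoords u v x 0 = (vertexPoint G u).1 := by
  ext w
  simp [suspensionCoords, vertexPoint_apply]

theorem suspensionCoords_one (x : V → ℝ) :
    suspensionCoords u v x 1 = (vertexPoint G v).1 := by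
  have h : (2 : ℝ) - 1 = 1 := by norm_num
  ext w
  simp [suspensionCoords, vertexPoint_apply, h]

variable [Finite V]

/-- The identification of the suspension of `|Ind(G \ N[e])|` with the subspace
`|Ind(e ⊔ (G \ N[e]))|` of `|Ind(G)|`. -/
noncomputable def suspensionMap (huv : G.Adj u v) :
    C(Suspension (IndSpace (G.induce (closedNbhdEdge G u v)ᶜ)), IndSpace G) :=
  Suspension.desc ⟨fun q => ⟨_, suspensionCoords_mem_realization huv q.1 q.2⟩, by
      classical
      refine Continuous.subtype_mk (continuous_pi fun w => ?_) _
      have hx : Continuous fun q : IndSpace (G.induce (closedNbhdEdge G u v)ᶜ) × I =>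
        (indInclusion G _ q.1).1 w := (continuous_apply w).comp
          (continuous_subtype_val.comp ((indInclusion G _).continuous.comp continuous_fst))
      unfold suspensionCoords
      exact ((continuous_if_const _ (fun _ => by fun_prop) fun _ => continuous_const).add
        (continuous_if_const _ (fun _ => by fun_prop) fun _ => continuous_const)).add
          (Continuous.mul (by fun_prop) hx)⟩
    (vertexPoint G u) (vertexPoint G v)
    (fun _ => Subtype.ext (suspensionCoords_zero _)) fun _ => Subtype.ext (suspensionCoords_one _)

omit [Finite V] in
theorem Suspension.cases {X : Type*} {P : Suspension X → Prop}
    (h : ∀ x, ∀ t : I, 0 < t → t < 1 → P (Quot.mk _ (Sum.inl (x, t))))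
    (h₀ : P (Quot.mk _ (Sum.inr false))) (h₁ : P (Quot.mk _ (Sum.inr true)))
    (c : Suspension X) : P c := by
  induction c using Quot.ind with
  | mk c =>
    rcases c with ⟨x, t⟩ | (_ | _)
    · rcases eq_or_ne t 0 with rfl | ht0
      · exact (Quot.sound (SuspensionRel.bot x)).symm ▸ h₀
      · rcases eq_or_ne t 1 with rfl | ht1
        · exact (Quot.sound (SuspensionRel.top x)).symm ▸ h₁
        · exact h x t (unitInterval.pos_iff_ne_zero.2 ht0) (unitInterval.lt_one_iff_ne_one.2 ht1)
    · exact h₀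
    · exact h₁

theorem suspensionMap_apply_eq_zero (huv : G.Adj u v)
    (c : Suspension (IndSpace (G.induce (closedNbhdEdge G u v)ᶜ))) {w : V}
    (hw : w ∉ ({u, v} ∪ (closedNbhdEdge G u v)ᶜ : Set V)) : (suspensionMap huv c).1 w = 0 := by
  simp only [Set.mem_union, Set.mem_insert_iff, Set.mem_singleton_iff, not_or] at hw
  induction c using Suspension.cases with
  | h l t =>
    refine (suspensionCoords_of_ne hw.1.1 hw.1.2 _ _).trans ?_
    rw [indInclusion_apply_of_notMem l hw.2, mul_zero]
  | h₀ => exact (vertexPoint_apply G u w).trans (if_neg hw.1.1)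
  | h₁ => exact (vertexPoint_apply G v w).trans (if_neg hw.1.2)

theorem suspensionMap_injective (huv : G.Adj u v) : Function.Injective (suspensionMap huv) := by
  have hl : ∀ (l : IndSpace (G.induce (closedNbhdEdge G u v)ᶜ)) (t : I),
      (suspensionMap huv (Quot.mk _ (Sum.inl (l, t)))).1 u = max (1 - 2 * (t : ℝ)) 0 := fun l t =>
    suspensionCoords_left huv.ne
      (indInclusion_apply_of_notMem l fun h => h (left_mem_closedNbhdEdge G u v)) t
  have hr : ∀ (l : IndSpace (G.induce (closedNbhdEdge G u v)ᶜ)) (t : I),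
      (suspensionMap huv (Quot.mk _ (Sum.inl (l, t)))).1 v = max (2 * (t : ℝ) - 1) 0 := fun l t =>
    suspensionCoords_right huv.ne
      (indInclusion_apply_of_notMem l fun h => h (right_mem_closedNbhdEdge G u v)) t
  have h₀ : (suspensionMap huv (Quot.mk _ (Sum.inr false))).1 u = 1 :=
    (vertexPoint_apply G u u).trans (if_pos rfl)
  have h₁ : (suspensionMap huv (Quot.mk _ (Sum.inr true))).1 v = 1 :=
    (vertexPoint_apply G v v).trans (if_pos rfl)
  have h₁' : (suspensionMap huv (Quot.mk _ (Sum.inr true))).1 u = 0 :=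
    (vertexPoint_apply G v u).trans (if_neg huv.ne)
  have hlt : ∀ (l : IndSpace (G.induce (closedNbhdEdge G u v)ᶜ)) (t : I), 0 < t →
      (suspensionMap huv (Quot.mk _ (Sum.inl (l, t)))).1 u < 1 := fun l t ht => by
    have : (0 : ℝ) < t := ht
    rw [hl]
    exact max_lt (by linarith) one_pos
  have hrt : ∀ (l : IndSpace (G.induce (closedNbhdEdge G u v)ᶜ)) (t : I), t < 1 →
      (suspensionMap huv (Quot.mk _ (Sum.inl (l, t)))).1 v < 1 := fun l t ht => by
    have : (t : ℝ) < 1 := ht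
    rw [hr]
    exact max_lt (by linarith) one_pos
  intro c c' hcc
  induction c using Suspension.cases with
  | h l t ht0 ht1 =>
    induction c' using Suspension.cases with
    | h l' t' ht0' ht1' =>
      have hu : max (1 - 2 * (t : ℝ)) 0 = max (1 - 2 * (t' : ℝ)) 0 := by rw [← hl l, hcc, hl]
      have hv : max (2 * (t : ℝ) - 1) 0 = max (2 * (t' : ℝ) - 1) 0 := by rw [← hr l, hcc, hr]
      obtain rfl : t = t' := by
        -- The coordinate at `v` minus that at `u` determines the suspension parameter.
        have hdiff : ∀ r : ℝ, max (2 * r - 1) 0 - max (1 - 2 * r) 0 = 2 * r - 1 := fun r => by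
          have := max_zero_sub_eq_self (2 * r - 1)
          rwa [neg_sub, max_comm, max_comm 0] at this
        have h1 := hdiff t
        rw [hu, hv, hdiff] at h1
        exact Subtype.ext (by linarith)
      have hpos : 1 - |2 * (t : ℝ) - 1| ≠ 0 := by
        have h0 : (0 : ℝ) < t := ht0
        have h1 : (t : ℝ) < 1 := ht1
        exact (sub_pos.2 (abs_lt.2 ⟨by linarith, by linarith⟩)).ne'
      obtain rfl : l = l' := by
        refine indInclusion_injective G _ ?_
        ext w
        by_cases hw : w ∈ closedNbhdEdge G u v
        · rw [indInclusion_apply_of_notMem l (fun h => h hw),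
            indInclusion_apply_of_notMem l' (fun h => h hw)]
        · have hwu : w ≠ u := fun h => hw (h ▸ left_mem_closedNbhdEdge G u v)
          have hwv : w ≠ v := fun h => hw (h ▸ right_mem_closedNbhdEdge G u v)
          have h := congrFun (congrArg Subtype.val hcc) w
          exact mul_left_cancel₀ hpos (((suspensionCoords_of_ne hwu hwv _ _).symm.trans h).trans
            (suspensionCoords_of_ne hwu hwv _ _))
      rfl
    | h₀ => exact absurd h₀ (hcc ▸ (hlt l t ht0).ne)
    | h₁ => exact absurd h₁ (hcc ▸ (hrt l t ht1).ne)
  | h₀ =>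
    induction c' using Suspension.cases with
    | h l t ht0 ht1 => exact absurd h₀ (hcc ▸ (hlt l t ht0).ne)
    | h₀ => rfl
    | h₁ => exact absurd (h₀.symm.trans (hcc ▸ h₁')) one_ne_zero
  | h₁ =>
    induction c' using Suspension.cases with
    | h l t ht0 ht1 => exact absurd h₁ (hcc ▸ (hrt l t ht1).ne)
    | h₀ => exact absurd (h₀.symm.trans (hcc ▸ h₁')) one_ne_zero
    | h₁ => rfl

theorem exists_suspensionMap_eq (huv : G.Adj u v) (z : IndSpace G)
    (hz : ∀ w ∉ ({u, v} ∪ (closedNbhdEdge G u v)ᶜ : Set V), z.1 w = 0) :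
    ∃ c, suspensionMap huv c = z := by
  classical
  have := Fintype.ofFinite V
  rcases (z.add_le_one huv.ne).eq_or_lt with h | h
  · have hoff := z.coordsOff_eq_zero huv.ne h
    rcases z.eq_zero_or huv with h0 | h0
    · refine ⟨Quot.mk _ (Sum.inr true), ?_⟩
      ext w
      rw [h0, zero_add] at h
      rw [← coordsOff_add huv.ne z.1 w, hoff, h, h0]
      exact (vertexPoint_apply G v w).trans (by simp)
    · refine ⟨Quot.mk _ (Sum.inr false), ?_⟩
      ext w
      rw [h0, add_zero] at h
      rw [← coordsOff_add huv.ne z.1 w, hoff, h, h0]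
      exact (vertexPoint_apply G u w).trans (by simp)
  -- `d` is the mass of `z` off `e`; dividing by it gives the point of `L` to be suspended.
  · set d := 1 - (z.1 u + z.1 v)
    have hd : 0 < d := sub_pos.2 h
    have hmem : (fun w => coordsOff u v z.1 w / d) ∈ Realization (Ind G) := by
      refine mem_realization_ind_iff.2
        ⟨fun w => div_nonneg (coordsOff_nonneg z.nonneg w) hd.le, ?_, fun a b hab => ?_⟩
      · rw [← Finset.sum_div, sum_coordsOff huv.ne, z.sum_eq_one, sub_sub]
        exact div_self hd.ne'
      · by_contra! hne
        exact (z.eq_zero_or hab).elim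
          (ne_of_coordsOff_ne_zero (left_ne_zero_of_mul hne.1)).2.2
          (ne_of_coordsOff_ne_zero (left_ne_zero_of_mul hne.2)).2.2
    let l := indRestrict (W := (closedNbhdEdge G u v)ᶜ) ⟨_, hmem⟩ fun w hw => by
      by_contra hne
      exact hw (notMem_closedNbhdEdge_of_coordsOff_ne_zero hz (left_ne_zero_of_mul hne))
    have hu := z.nonneg u
    have hv := z.nonneg v
    -- Chosen so that `2 * t - 1 = z v - z u`. As one of the two coordinates is zero, the absolute
    -- value is their sum `1 - d`.
    let t : I := ⟨(1 + z.1 v - z.1 u) / 2, by linarith, by linarith⟩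
    have ht : 2 * (t : ℝ) - 1 = z.1 v - z.1 u := by
      change 2 * ((1 + z.1 v - z.1 u) / 2) - 1 = _
      ring
    have ht' : 1 - 2 * (t : ℝ) = z.1 u - z.1 v := by linarith
    have habs : 1 - |2 * (t : ℝ) - 1| = d ∧ max (2 * (t : ℝ) - 1) 0 = z.1 v ∧
        max (1 - 2 * (t : ℝ)) 0 = z.1 u := by
      rw [ht, ht']
      rcases z.eq_zero_or huv with h0 | h0
      · simp [d, h0, hv, abs_of_nonneg]
      · simp [d, h0, hu, abs_of_nonneg]
    refine ⟨Quot.mk _ (Sum.inl (l, t)), ?_⟩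
    ext w
    change suspensionCoords u v (indInclusion G _ l).1 t w = _
    rw [indInclusion_indRestrict, suspensionCoords, habs.1, habs.2.1, habs.2.2,
      mul_div_cancel₀ _ hd.ne', coordsOff_add huv.ne]

end Suspension

end IndComplex

namespace IndComplex

/-! ### `Ind(G - e)` as a mapping cone -/

section EdgeDeletion

open unitInterval

variable {V : Type*} {G : SimpleGraph V} {u v : V}

theorem IndSpace.mem_deleteEdges [Finite V] (x : IndSpace G) (s : Set (Sym2 V)) :
    x.1 ∈ Realization (Ind (G.deleteEdges s)) := by
  have := Fintype.ofFinite V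
  exact mem_realization_ind_iff.2 ⟨x.nonneg, x.sum_eq_one, fun a b hab =>
    x.eq_zero_or (G.deleteEdges_le s hab)⟩

theorem deleteEdges_adj_of_ne {a b : V} (hab : G.Adj a b) (ha : ¬(a = u ∧ b = v))
    (hb : ¬(a = v ∧ b = u)) : (G.deleteEdges {s(u, v)}).Adj a b := by
  rw [SimpleGraph.deleteEdges_adj]
  refine ⟨hab, fun h => ?_⟩
  rcases Sym2.eq_iff.1 h with h | h
  exacts [ha h, hb h]

open Classical in
/-- The coordinates of the point at height `s` on the segment from `x` to the midpoint of the edge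
`(u,v)`. -/
noncomputable def towardMidpoint (u v : V) (x : V → ℝ) (s : ℝ) (w : V) : ℝ :=
  (1 - s) * x w + ((if w = u then s / 2 else 0) + if w = v then s / 2 else 0)

theorem towardMidpoint_left (huv : u ≠ v) (x : V → ℝ) (s : ℝ) :
    towardMidpoint u v x s u = (1 - s) * x u + s / 2 := by
  simp [towardMidpoint, huv]

theorem towardMidpoint_right (huv : u ≠ v) (x : V → ℝ) (s : ℝ) :
    towardMidpoint u v x s v = (1 - s) * x v + s / 2 := by
  simp [towardMidpoint, huv.symm]

theorem towardMidpoint_of_ne {w : V} (hu : w ≠ u) (hv : w ≠ v) (x : V → ℝ) (s : ℝ) :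
    towardMidpoint u v x s w = (1 - s) * x w := by
  simp [towardMidpoint, hu, hv]

theorem towardMidpoint_zero (x : V → ℝ) : towardMidpoint u v x 0 = x := by
  ext w
  simp [towardMidpoint]

theorem towardMidpoint_one (x y : V → ℝ) : towardMidpoint u v x 1 = towardMidpoint u v y 1 := by
  ext w
  simp [towardMidpoint]

variable [Finite V]

theorem towardMidpoint_mem_realization (huv : G.Adj u v) (x : IndSpace G)
    (hx : ∀ w ∉ ({u, v} ∪ (closedNbhdEdge G u v)ᶜ : Set V), x.1 w = 0) (s : I) :
    towardMidpoint u v x.1 s ∈ Realization (Ind (G.deleteEdges {s(u, v)})) := by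
  classical
  have := Fintype.ofFinite V
  have hs0 : 0 ≤ (s : ℝ) := s.2.1
  have hs1 : 0 ≤ 1 - (s : ℝ) := by linarith [s.2.2]
  refine mem_realization_ind_iff.2 ⟨fun w => ?_, ?_, fun a b hab => ?_⟩
  · have h1 := mul_nonneg hs1 (x.nonneg w)
    unfold towardMidpoint
    split_ifs <;> positivity
  · simp only [towardMidpoint]
    rw [Finset.sum_add_distrib, Finset.sum_add_distrib, ← Finset.mul_sum, x.sum_eq_one,
      Finset.sum_ite_eq', Finset.sum_ite_eq']
    simp only [Finset.mem_univ, if_true]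
    ring
  · have hcases : ∀ w, towardMidpoint u v x.1 s w ≠ 0 →
        (w = u ∨ w = v) ∨ (w ∉ closedNbhdEdge G u v ∧ x.1 w ≠ 0) := fun w hw => by
      by_cases h : w = u ∨ w = v
      · exact .inl h
      · have h' := not_or.1 h
        rw [towardMidpoint_of_ne h'.1 h'.2] at hw
        have hxw := right_ne_zero_of_mul hw
        refine .inr ⟨?_, hxw⟩
        rcases not_imp_comm.1 (hx w) hxw with h'' | h''
        exacts [absurd h'' h, h'']
    rw [SimpleGraph.deleteEdges_adj] at hab
    obtain ⟨hab, hne⟩ := hab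
    by_contra! h
    rcases hcases a h.1 with (rfl | rfl) | ⟨ha, ha'⟩ <;>
      rcases hcases b h.2 with (rfl | rfl) | ⟨hb, hb'⟩
    · exact hab.ne rfl
    · exact hne rfl
    · exact hb (.inl (.inr hab))
    · exact hne Sym2.eq_swap
    · exact hab.ne rfl
    · exact hb (.inr (.inr hab))
    · exact ha (.inl (.inr hab.symm))
    · exact ha (.inr (.inr hab.symm))
    · exact (x.eq_zero_or hab).elim ha' hb'

/-- The midpoint of the simplex `{u, v}` of `Ind(G - e)`. -/
noncomputable def edgeMidpoint (huv : G.Adj u v) : IndSpace (G.deleteEdges {s(u, v)}) :=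
  -- The pole is an arbitrary choice: at height `1` the starting point has weight `0`.
  ⟨_, towardMidpoint_mem_realization huv (suspensionMap huv (Suspension.pole _))
    (fun _ hw => suspensionMap_apply_eq_zero huv _ hw) 1⟩

/-- The map from the mapping cone of `suspensionMap` to `|Ind(G - e)|` which is affine on the cone
lines and sends the apex to the midpoint of `e`. -/
noncomputable def coneMap (huv : G.Adj u v) :
    C(MappingCone (suspensionMap huv : _ → IndSpace G), IndSpace (G.deleteEdges {s(u, v)})) :=
  MappingCone.desc _
    ⟨fun x => ⟨x.1, x.mem_deleteEdges _⟩, Continuous.subtype_mk continuous_subtype_val _⟩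
    ⟨fun q => ⟨_, towardMidpoint_mem_realization huv (suspensionMap huv q.1)
      (fun _ hw => suspensionMap_apply_eq_zero huv _ hw) q.2⟩, by
      classical
      refine Continuous.subtype_mk (continuous_pi fun w => ?_) _
      have hx : Continuous fun q : Suspension (IndSpace (G.induce (closedNbhdEdge G u v)ᶜ)) × I =>
        (suspensionMap huv q.1).1 w := (continuous_apply w).comp
          (continuous_subtype_val.comp ((suspensionMap huv).continuous.comp continuous_fst))
      unfold towardMidpoint
      exact (Continuous.mul (by fun_prop) hx).add
        ((continuous_if_const _ (fun _ => by fun_prop) fun _ => continuous_const).add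
          (continuous_if_const _ (fun _ => by fun_prop) fun _ => continuous_const))⟩
    (edgeMidpoint huv) (fun _ => Subtype.ext (towardMidpoint_zero _))
    fun _ => Subtype.ext (towardMidpoint_one _ _)

theorem coneMap_side (huv : G.Adj u v)
    (c : Suspension (IndSpace (G.induce (closedNbhdEdge G u v)ᶜ))) (s : I) :
    (coneMap huv (MappingCone.side _ (c, s))).1 = towardMidpoint u v (suspensionMap huv c).1 s :=
  rfl

theorem IndSpace.min_eq_zero (x : IndSpace G) (huv : G.Adj u v) : min (x.1 u) (x.1 v) = 0 := by
  rcases x.eq_zero_or huv with h | h <;> rw [h]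
  exacts [min_eq_left (x.nonneg v), min_eq_right (x.nonneg u)]

theorem min_coneMap_base (huv : G.Adj u v) (x : IndSpace G) :
    min ((coneMap huv (MappingCone.base _ x)).1 u) ((coneMap huv (MappingCone.base _ x)).1 v) = 0 :=
  x.min_eq_zero huv

/-- The smaller of the coordinates at `u` and `v` recovers the height in the cone, since it is zero
at the starting point in `Ind(G)`. -/
theorem min_coneMap_side (huv : G.Adj u v)
    (c : Suspension (IndSpace (G.induce (closedNbhdEdge G u v)ᶜ))) (s : I) :
    min ((coneMap huv (MappingCone.side _ (c, s))).1 u)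
      ((coneMap huv (MappingCone.side _ (c, s))).1 v) = s / 2 := by
  have hs1 : 0 ≤ 1 - (s : ℝ) := by linarith [s.2.2]
  rw [coneMap_side, towardMidpoint_left huv.ne, towardMidpoint_right huv.ne, min_add_add_right,
    ← mul_min_of_nonneg _ _ hs1, (suspensionMap huv c).min_eq_zero huv, mul_zero, zero_add]

theorem exists_of_mappingCone {A X : Type*} {f : A → X} (c : MappingCone f) :
    (∃ x, c = MappingCone.base f x) ∨ c = MappingCone.apex f ∨
      ∃ a, ∃ t : I, (t : ℝ) ≠ 0 ∧ (t : ℝ) ≠ 1 ∧ c = MappingCone.side f (a, t) := by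
  induction c using MappingCone.ind with
  | hb x => exact .inl ⟨x, rfl⟩
  | ha => exact .inr (.inl rfl)
  | hs a t =>
    rcases eq_or_ne t 0 with rfl | h0
    · exact .inl ⟨_, MappingCone.side_zero f a⟩
    · rcases eq_or_ne t 1 with rfl | h1
      · exact .inr (.inl (MappingCone.side_one f a))
      · exact .inr (.inr ⟨a, t, fun h => h0 (Subtype.ext h), fun h => h1 (Subtype.ext h), rfl⟩)

/-- The minimum is `0` on the base, `1 / 2` at the apex and `s / 2` in between, which separates the
three kinds of points. At equal heights `s ≠ 1` the factor `1 - s` cancels. -/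
theorem coneMap_injective (huv : G.Adj u v) : Function.Injective (coneMap huv) := by
  have hb := min_coneMap_base huv
  have hs := min_coneMap_side huv
  have ha : min ((coneMap huv (MappingCone.apex _)).1 u)
      ((coneMap huv (MappingCone.apex _)).1 v) = 1 / 2 := hs (Suspension.pole _) 1
  intro c c' hcc
  rcases exists_of_mappingCone c with ⟨x, rfl⟩ | rfl | ⟨a, s, hs0, hs1, rfl⟩ <;>
    rcases exists_of_mappingCone c' with ⟨x', rfl⟩ | rfl | ⟨a', s', hs0', hs1', rfl⟩
  · have h : x.1 = x'.1 := (Subtype.ext_iff.1 hcc :)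
    rw [Subtype.ext h]
  · have := hb x
    rw [hcc, ha] at this
    norm_num at this
  · have := hb x
    rw [hcc, hs] at this
    exact absurd (by linarith) hs0'
  · have := hb x'
    rw [← hcc, ha] at this
    norm_num at this
  · rfl
  · have := hs a' s'
    rw [← hcc, ha] at this
    exact absurd (by linarith) hs1'
  · have := hb x'
    rw [← hcc, hs] at this
    exact absurd (by linarith) hs0
  · have := hs a s
    rw [hcc, ha] at this
    exact absurd (by linarith) hs1
  · have h := hs a s
    rw [hcc, hs] at h
    obtain rfl : s = s' := Subtype.ext (by linarith)
    obtain rfl : a = a' := by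
      refine suspensionMap_injective huv (Subtype.ext (funext fun w => ?_))
      have h := congrFun (congrArg Subtype.val hcc) w
      exact mul_left_cancel₀ (sub_ne_zero.2 hs1.symm) (add_right_cancel h)
    rfl

theorem coneMap_surjective (huv : G.Adj u v) : Function.Surjective (coneMap huv) := by
  classical
  have := Fintype.ofFinite V
  intro y
  by_cases h0 : y.1 u = 0 ∨ y.1 v = 0
  · refine ⟨MappingCone.base _ ⟨y.1, mem_realization_ind_iff.2 ⟨y.nonneg, y.sum_eq_one,
      fun a b hab => ?_⟩⟩, rfl⟩
    by_cases h1 : a = u ∧ b = v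
    · rwa [h1.1, h1.2]
    by_cases h2 : a = v ∧ b = u
    · rwa [h2.1, h2.2, or_comm]
    exact y.eq_zero_or (deleteEdges_adj_of_ne hab h1 h2)
  · rw [not_or] at h0
    -- Both ends of `e` now carry mass, so no other vertex of `N[e]` can.
    have hoff : ∀ w ∈ closedNbhdEdge G u v, w ≠ u → w ≠ v → y.1 w = 0 := by
      rintro w ((rfl | hw) | (rfl | hw)) hu hv
      · exact absurd rfl hu
      · exact (y.eq_zero_or (deleteEdges_adj_of_ne hw (fun h => hv h.2)
          fun h => huv.ne h.1)).resolve_left h0.1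
      · exact absurd rfl hv
      · exact (y.eq_zero_or (deleteEdges_adj_of_ne hw (fun h => huv.ne h.1.symm)
          fun h => hu h.2)).resolve_left h0.2
    set m := min (y.1 u) (y.1 v) with hm
    have hmu : m ≤ y.1 u := min_le_left _ _
    have hmv : m ≤ y.1 v := min_le_right _ _
    have hm0 : 0 ≤ m := le_min (y.nonneg u) (y.nonneg v)
    have hle := y.add_le_one huv.ne
    let s : I := ⟨2 * m, by linarith, by linarith⟩
    have hsm : (s : ℝ) / 2 = m := by
      change 2 * m / 2 = m
      ring
    rcases (show 2 * m ≤ 1 by linarith).eq_or_lt with h1 | h1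
    · refine ⟨MappingCone.apex _, ?_⟩
      have hc := y.coordsOff_eq_zero huv.ne (by linarith)
      have hu : y.1 u = 1 / 2 := by linarith
      have hv : y.1 v = 1 / 2 := by linarith
      ext w
      rw [← coordsOff_add huv.ne y.1 w, hc, hu, hv]
      change towardMidpoint u v _ 1 w = _
      simp [towardMidpoint]
    · have hd : 0 < 1 - 2 * m := sub_pos.2 h1
      -- The cone line through `y` is traced back to the base: removing the common mass `m` from `u`
      -- and `v` kills one of them, and the rest is rescaled to total mass `1`.
      let z : V → ℝ := fun w => (y.1 w - ((if w = u then m else 0) + if w = v then m else 0)) /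
        (1 - 2 * m)
      have hzu : z u = (y.1 u - m) / (1 - 2 * m) := by simp [z, huv.ne]
      have hzv : z v = (y.1 v - m) / (1 - 2 * m) := by simp [z, huv.ne']
      have hzw : ∀ w, w ≠ u → w ≠ v → z w = y.1 w / (1 - 2 * m) := fun w hu hv => by
        simp [z, hu, hv]
      have hend : z u = 0 ∨ z v = 0 := by
        rcases min_choice (y.1 u) (y.1 v) with h | h
        · exact .inl (by rw [hzu, hm, h, sub_self, zero_div])
        · exact .inr (by rw [hzv, hm, h, sub_self, zero_div])
      have hzy : ∀ w, z w ≠ 0 → y.1 w ≠ 0 := fun w hw => by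
        by_cases hu : w = u
        · exact hu ▸ h0.1
        · by_cases hv : w = v
          · exact hv ▸ h0.2
          · exact left_ne_zero_of_mul ((hzw w hu hv) ▸ hw)
      have hzmem : z ∈ Realization (Ind G) := by
        refine mem_realization_ind_iff.2 ⟨fun w => ?_, ?_, fun a b hab => ?_⟩
        · by_cases hu : w = u
          · rw [hu, hzu]
            exact div_nonneg (by linarith) hd.le
          · by_cases hv : w = v
            · rw [hv, hzv]
              exact div_nonneg (by linarith) hd.le
            · rw [hzw w hu hv]
              exact div_nonneg (y.nonneg w) hd.le
        · simp only [z]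
          rw [← Finset.sum_div, Finset.sum_sub_distrib, Finset.sum_add_distrib, y.sum_eq_one,
            Finset.sum_ite_eq', Finset.sum_ite_eq']
          simp only [Finset.mem_univ, if_true]
          rw [← two_mul, div_self hd.ne']
        · by_cases h1 : a = u ∧ b = v
          · rwa [h1.1, h1.2]
          by_cases h2 : a = v ∧ b = u
          · rwa [h2.1, h2.2, or_comm]
          by_contra! h
          exact (y.eq_zero_or (deleteEdges_adj_of_ne hab h1 h2)).elim (hzy a h.1) (hzy b h.2)
      obtain ⟨c, hc⟩ := exists_suspensionMap_eq huv ⟨z, hzmem⟩ fun w hw => by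
        simp only [Set.mem_union, Set.mem_insert_iff, Set.mem_singleton_iff, not_or,
          Set.mem_compl_iff, not_not] at hw
        change z w = 0
        rw [hzw w hw.1.1 hw.1.2, hoff w hw.2 hw.1.1 hw.1.2, zero_div]
      refine ⟨MappingCone.side _ (c, s), Subtype.ext (funext fun w => ?_)⟩
      rw [coneMap_side, hc, towardMidpoint, hsm]
      change (1 - 2 * m) * ((y.1 w - _) / (1 - 2 * m)) + _ = _
      rw [mul_div_cancel₀ _ hd.ne', sub_add_cancel]

/-- `|Ind(G - e)|` is the mapping cone of the inclusion of the suspension of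
`|Ind(G \ N[e])|` into `|Ind(G)|`. -/
noncomputable def coneHomeomorph (huv : G.Adj u v) :
    MappingCone (suspensionMap huv : _ → IndSpace G) ≃ₜ IndSpace (G.deleteEdges {s(u, v)}) :=
  Continuous.homeoOfEquivCompactToT2
    (f := Equiv.ofBijective (coneMap huv) ⟨coneMap_injective huv, coneMap_surjective huv⟩)
    (coneMap huv).continuous

/-- A homotopy from the inclusion of `|Ind(e ⊔ (G \ N[e]))|` to a constant map yields one from
`suspensionMap`. -/
theorem suspensionMap_homotopic_const (huv : G.Adj u v) {p : IndSpace G}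
    (h : (indInclusion G ({u, v} ∪ (closedNbhdEdge G u v)ᶜ)).Homotopic
      (ContinuousMap.const _ p)) :
    (suspensionMap huv).Homotopic (ContinuousMap.const _ p) := by
  let r : C(Suspension (IndSpace (G.induce (closedNbhdEdge G u v)ᶜ)),
      IndSpace (G.induce ({u, v} ∪ (closedNbhdEdge G u v)ᶜ))) :=
    ⟨fun c => indRestrict (suspensionMap huv c) fun _ hw => suspensionMap_apply_eq_zero huv c hw, by
      unfold indRestrict
      refine Continuous.subtype_mk (continuous_pi fun w => ?_) _
      exact (continuous_apply (w : V)).comp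
        (continuous_subtype_val.comp (suspensionMap huv).continuous)⟩
  have hr : (indInclusion G ({u, v} ∪ (closedNbhdEdge G u v)ᶜ)).comp r = suspensionMap huv :=
    ContinuousMap.ext fun c => indInclusion_indRestrict _
      fun _ hw => suspensionMap_apply_eq_zero huv c hw
  rw [← hr]
  exact h.comp (.refl r)

end EdgeDeletion

end IndComplex

theorem mainTheorem6 {V : Type*} [Finite V] (G : SimpleGraph V) (u v : V) (huv : G.Adj u v)
    (T : Set V) (huT : u ∈ T) (hvT : v ∈ T)
    (hcontr : ContractibleSpace (IndComplex.IndSpace (G.induce T)))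
    (hN : ∀ x ∈ T, IndComplex.closedNbhd G x ⊆ IndComplex.closedNbhdEdge G u v) :
    (IndComplex.indInclusion G ({u, v} ∪ (IndComplex.closedNbhdEdge G u v)ᶜ)).Nullhomotopic ∧
    ∀ p : IndComplex.IndSpace G, Joined (IndComplex.vertexPoint G u) p →
      Nonempty (ContinuousMap.HomotopyEquiv
        (IndComplex.IndSpace (G.deleteEdges {s(u, v)}))
        (IndComplex.Wedge p (IndComplex.Suspension.pole (IndComplex.Suspension
          (IndComplex.IndSpace (G.induce (IndComplex.closedNbhdEdge G u v)ᶜ)))))) := by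
  have h := IndComplex.indInclusion_homotopic_const huv huT hvT (PathConnectedSpace.joined _ _) hN
  refine ⟨⟨_, h⟩, fun p hp => ?_⟩
  -- The poles make the suspension nonempty even when `L` is empty;
  -- `ContinuousMap.homotopic_const_iff` relies on this to turn the path from `u` to `p` into a
  -- homotopy of constant maps.
  have : Nonempty (IndComplex.Suspension (IndComplex.IndSpace
      (G.induce (IndComplex.closedNbhdEdge G u v)ᶜ))) := ⟨IndComplex.Suspension.pole _⟩
  obtain ⟨H⟩ := (IndComplex.suspensionMap_homotopic_const huv h).trans
    (ContinuousMap.homotopic_const_iff.2 hp)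
  exact ⟨((IndComplex.coneHomeomorph huv).symm.toHomotopyEquiv.trans
    (IndComplex.MappingCone.homotopyEquivOfHomotopy H)).trans
    (IndComplex.MappingCone.constHomeomorph p).toHomotopyEquiv⟩
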